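/- A field $K$ is called pseudo algebraically closed (PAC) if every variety defined over $K$ has a $K$-rational point; here a variety defined over $K$ is an absolutely irreducible affine variety, that is, the zero set of an ideal $I\subseteq K[X_1,\dots,X_m]$ whose extension $I\cdot\overline{K}[X_1,\dots,X_m]$ to an algebraic closure $\overline{K}$ of $K$ is a prime ideal. A scaled trace form over $K$ is a quadratic form $F\to K$, $x\mapsto \mathrm{Tr}_{F/K}(\alpha x^2)$, where $F/K$ is a finite separable field extension and $\alpha\in F$ is nonzero. Theorem. Let $K$ be a PAC field of characteristic $\neq 2$, and let $Q$ be a non-degenerate quadratic form on a $K$-vector space of finite dimension $n$. Then $Q$ is isomorphic (isometric) to a scaled trace form over $K$ if and only if $K$ has a finite separable field extension of degree $n$. -/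

import Mathlib

universe u v

/-- A field `K` is *pseudo algebraically closed* (PAC) if every variety defined over `K` has a
`K`-rational point.  A variety defined over `K` is here an absolutely irreducible affine variety:
the zero set in affine `m`-space of an ideal `I` of `K[X₁, …, Xₘ]` whose extension to the
polynomial ring over an algebraic closure of `K` is a prime ideal.  (A prime ideal is proper, so
such a variety is nonempty; every abstract or projective variety over `K` contains a nonempty open
affine one.) -/
def IsPAC (K : Type u) [Field K] : Prop :=
  ∀ (m : ℕ) (I : Ideal (MvPolynomial (Fin m) K)),
    (I.map (MvPolynomial.map (algebraMap K (AlgebraicClosure K)))).IsPrime →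
      ∃ x : Fin m → K, ∀ f ∈ I, MvPolynomial.eval x f = 0

/-- The quadratic form `x ↦ Tr_{F/K} (α x²)` on `F`. -/
noncomputable def scaledTraceForm (K : Type u) (F : Type v) [Field K] [Field F] [Algebra K F]
    (α : F) : QuadraticForm K F :=
  ((Algebra.trace K F).comp (LinearMap.mulLeft K α)).compQuadraticMap
    (QuadraticMap.sq : QuadraticMap K F F)

theorem scaledTraceForm_apply (K : Type u) (F : Type v) [Field K] [Field F] [Algebra K F]
    (α x : F) : scaledTraceForm K F α x = Algebra.trace K F (α * x ^ 2) := by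
  simp [scaledTraceForm, sq]

/-- `Q` is isomorphic to a scaled trace form: there are a finite separable extension `F / K` and a
nonzero `α ∈ F` such that `Q` is isometric to `x ↦ Tr_{F/K} (α x²)`. -/
def IsIsomorphicToScaledTraceForm {K : Type u} {V : Type v} [Field K] [AddCommGroup V]
    [Module K V] (Q : QuadraticForm K V) : Prop :=
  ∃ (F : Type u) (_ : Field F) (_ : Algebra K F),
    FiniteDimensional K F ∧ Algebra.IsSeparable K F ∧
      ∃ α : F, α ≠ 0 ∧ QuadraticMap.Equivalent Q (scaledTraceForm K F α)

/-- `K` has a (finite) separable field extension of degree `n`. -/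
def HasSeparableExtensionOfDegree (K : Type u) [Field K] (n : ℕ) : Prop :=
  ∃ (F : Type u) (_ : Field F) (_ : Algebra K F),
    FiniteDimensional K F ∧ Algebra.IsSeparable K F ∧ Module.finrank K F = n

/-! Over a PAC field of characteristic not 2, dimension and discriminant (modulo squares) classify
nondegenerate forms, so it suffices to find a scaled trace form with the discriminant of $Q$. Both
ingredients come from one variety. If a form splits over $\overline K$ into as many independent
linear factors as variables, then a linear change turns $f = c$ into $\prod X_j = c$, irreducible
for $c \ne 0$; by PAC, $f$ represents $c$ (`IsPAC.exists_eval_eq`). For binary quadratic forms this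
gives universality, hence $Q \cong \langle d, 1, \dots, 1\rangle$. For the norm form of $F/K$, whose
factors are the conjugates, it gives surjectivity of the norm onto $K^\times$. Since $x \mapsto
\mathrm{Tr}(\alpha x^2)$ has discriminant $\mathrm{disc}(F/K)\, N(\alpha)$, some $\alpha$ gives the
required value. The converse only compares dimensions. -/

/-! ### Irreducibility of products of linear forms minus a constant -/

open MvPolynomial in
theorem MvPolynomial.irreducible_prod_X_sub_C {R : Type*} [Field R] {n : ℕ} {c : R} (hc : c ≠ 0) :
    Irreducible (∏ j : Fin (n + 1), (X j : MvPolynomial (Fin (n + 1)) R) - C c) := by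
  -- Degree one in `X 0`, with a unit as constant term, hence coprime to the leading coefficient.
  have key : Irreducible ((∏ j : Fin n, (X j.succ : MvPolynomial (Fin (n + 1)) R)) * X 0 + C (-c)) := by
    apply irreducible_mul_X_add
    · exact Finset.prod_ne_zero_iff.2 fun j _ ↦ X_ne_zero _
    · intro h
      obtain ⟨j, -, hj⟩ := Finset.mem_biUnion.1 (vars_prod _ h)
      rw [vars_X, Finset.mem_singleton] at hj
      exact Fin.succ_ne_zero j hj.symm
    · simp
    · exact IsUnit.isRelPrime_right ((isUnit_iff_ne_zero.2 (neg_ne_zero.2 hc)).map C)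
  rwa [C_neg, ← sub_eq_add_neg, mul_comm, ← Fin.prod_univ_succ] at key

open MvPolynomial in
/-- The linear change of variables given by an invertible matrix. -/
noncomputable def MvPolynomial.linearChange {R σ : Type*} [CommRing R] [Fintype σ]
    (M : Matrix σ σ R) : MvPolynomial σ R →ₐ[R] MvPolynomial σ R :=
  aeval fun j ↦ ∑ i, C (M j i) * X i

open MvPolynomial in
theorem MvPolynomial.linearChange_comp {R σ : Type*} [CommRing R] [Fintype σ]
    (M N : Matrix σ σ R) :
    (linearChange M).comp (linearChange N) = linearChange (N * M) := by
  ext1 j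
  simp only [linearChange, AlgHom.comp_apply, aeval_X, map_sum, map_mul, algHom_C,
    algebraMap_eq, Matrix.mul_apply, Finset.sum_mul, Finset.mul_sum]
  rw [Finset.sum_comm]
  simp only [mul_assoc]

open MvPolynomial in
theorem MvPolynomial.linearChange_one {R σ : Type*} [CommRing R] [Fintype σ] [DecidableEq σ] :
    linearChange (1 : Matrix σ σ R) = AlgHom.id R _ := by
  ext1 j
  simp [linearChange, Matrix.one_apply]

open MvPolynomial in
theorem MvPolynomial.irreducible_prod_linear_sub_C {R : Type*} [Field R] {n : ℕ}
    {M : Matrix (Fin (n + 1)) (Fin (n + 1)) R} (hM : M.det ≠ 0) {c : R} (hc : c ≠ 0) :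
    Irreducible (∏ j, (∑ i, C (M j i) * X i) - C c : MvPolynomial (Fin (n + 1)) R) := by
  have hu : IsUnit M.det := isUnit_iff_ne_zero.2 hM
  let e : MvPolynomial (Fin (n + 1)) R ≃ₐ[R] MvPolynomial (Fin (n + 1)) R :=
    AlgEquiv.ofAlgHom (linearChange M) (linearChange M⁻¹)
      (by rw [linearChange_comp, Matrix.nonsing_inv_mul _ hu, linearChange_one])
      (by rw [linearChange_comp, Matrix.mul_nonsing_inv _ hu, linearChange_one])
  have he : e (∏ j, X j - C c) = ∏ j, (∑ i, C (M j i) * X i) - C c := by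
    simp [e, linearChange, MvPolynomial.algebraMap_eq]
  rw [← he]
  exact (MulEquiv.irreducible_iff e).2 (irreducible_prod_X_sub_C hc)

/-! ### Values of split forms over a PAC field -/

open MvPolynomial in
/-- Over a PAC field, a form that splits over the algebraic closure into linearly independent
linear factors, as many as there are variables, represents every nonzero scalar. -/
theorem IsPAC.exists_eval_eq {K : Type u} [Field K] (hK : IsPAC K) {n : ℕ}
    (f : MvPolynomial (Fin (n + 1)) K)
    {M : Matrix (Fin (n + 1)) (Fin (n + 1)) (AlgebraicClosure K)} (hM : M.det ≠ 0)
    (hf : MvPolynomial.map (algebraMap K (AlgebraicClosure K)) f = ∏ j, ∑ i, C (M j i) * X i)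
    {c : K} (hc : c ≠ 0) : ∃ x, eval x f = c := by
  have hirr := irreducible_prod_linear_sub_C hM
    ((map_ne_zero (algebraMap K (AlgebraicClosure K))).2 hc)
  obtain ⟨x, hx⟩ := hK _ (Ideal.span {f - C c}) (by
    rw [Ideal.map_span, Set.image_singleton, map_sub, hf, map_C,
      Ideal.span_singleton_prime hirr.ne_zero]
    exact hirr.prime)
  refine ⟨x, ?_⟩
  simpa [sub_eq_zero] using hx _ (Ideal.mem_span_singleton_self _)

-- With $s^2 = a$ and $t^2 = -b$ the form factors as $(sx + ty)(sx - ty)$; the factors are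
-- independent because $2st \ne 0$.
open MvPolynomial in
theorem IsPAC.exists_binary_eq {K : Type u} [Field K] (hK : IsPAC K) (h2 : (2 : K) ≠ 0)
    {a b c : K} (ha : a ≠ 0) (hb : b ≠ 0) (hc : c ≠ 0) :
    ∃ x y : K, a * (x * x) + b * (y * y) = c := by
  obtain ⟨s, hs⟩ := IsAlgClosed.exists_pow_nat_eq (algebraMap K (AlgebraicClosure K) a) two_pos
  obtain ⟨t, ht⟩ := IsAlgClosed.exists_pow_nat_eq (algebraMap K (AlgebraicClosure K) (-b)) two_pos
  have hs0 : s ≠ 0 := by rintro rfl; rw [zero_pow two_ne_zero, eq_comm, map_eq_zero] at hs; exact ha hs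
  have ht0 : t ≠ 0 := by rintro rfl; rw [zero_pow two_ne_zero, eq_comm, map_eq_zero] at ht; exact hb (neg_eq_zero.1 ht)
  have h2' : (2 : AlgebraicClosure K) ≠ 0 := by
    rw [← map_ofNat (algebraMap K (AlgebraicClosure K)) 2]
    exact (map_ne_zero _).2 h2
  obtain ⟨x, hx⟩ := hK.exists_eval_eq (n := 1) (C a * X 0 ^ 2 + C b * X 1 ^ 2)
    (M := !![s, t; s, -t]) (by
      rw [Matrix.det_fin_two_of]
      have : s * -t - t * s = -(2 * (s * t)) := by ring
      rw [this]
      exact neg_ne_zero.2 (mul_ne_zero h2' (mul_ne_zero hs0 ht0))) (by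
      have hb' : algebraMap K (AlgebraicClosure K) b = -t ^ 2 := by rw [ht, map_neg, neg_neg]
      simp only [Nat.reduceAdd, map_add, map_mul, map_C, map_pow, map_X, ← hs, hb', C_neg,
        Fin.prod_univ_two, Fin.sum_univ_two, Matrix.of_apply, Matrix.cons_val_zero,
        Matrix.cons_val_one, Fin.isValue]
      ring) hc
  exact ⟨x 0, x 1, by simpa [sq] using hx⟩

open MvPolynomial in
/-- The norm of a finite separable extension of a PAC field is surjective. -/
theorem IsPAC.exists_norm_eq {K : Type u} [Field K] (hK : IsPAC K) {F : Type v} [Field F]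
    [Algebra K F] [FiniteDimensional K F] [Algebra.IsSeparable K F] {c : K} (hc : c ≠ 0) :
    ∃ x : F, Algebra.norm K x = c := by
  obtain ⟨n, hn⟩ := Nat.exists_eq_succ_of_ne_zero (Module.finrank_pos (R := K) (M := F)).ne'
  let b : Module.Basis (Fin (n + 1)) K F := Module.finBasisOfFinrankEq K F hn
  let Ω := AlgebraicClosure K
  let e : Fin (n + 1) ≃ (F →ₐ[K] Ω) := (Fintype.equivFinOfCardEq (by
    rw [AlgHom.card, hn])).symm
  let M : Matrix (Fin (n + 1)) (Fin (n + 1)) Ω := Matrix.of fun j i ↦ e j (b i)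
  -- The square of this determinant is the discriminant of `b`, nonzero by separability.
  have hM : M.det ≠ 0 := by
    have h := Algebra.discr_eq_det_embeddingsMatrixReindex_pow_two K Ω b e
    have h' : M = (Algebra.embeddingsMatrixReindex K Ω b e).transpose := by
      ext i j; simp [M, Algebra.embeddingsMatrixReindex, Algebra.embeddingsMatrix]
    rw [h', Matrix.det_transpose]
    intro h0
    rw [h0, zero_pow two_ne_zero, map_eq_zero] at h
    exact Algebra.discr_not_zero_of_basis K b h
  -- Multiplication by the generic element $\sum X_i b_i$; its determinant is the norm form.
  let A : Matrix (Fin (n + 1)) (Fin (n + 1)) (MvPolynomial (Fin (n + 1)) K) :=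
    Matrix.of fun k l ↦ ∑ i, C (Algebra.leftMulMatrix b (b i) k l) * X i
  have hmul (j k i) : ∑ l, M j l * algebraMap K Ω (Algebra.leftMulMatrix b (b i) l k) =
      M j i * M j k := by
    have := congrArg (e j) (b.sum_repr (b i * b k))
    rw [map_mul (e j), map_sum] at this
    simp only [M, Matrix.of_apply, Algebra.leftMulMatrix_eq_repr_mul]
    rw [← this]
    refine Finset.sum_congr rfl fun _ _ ↦ ?_
    rw [map_smul, Algebra.smul_def, mul_comm]
  -- Row $j$ of `M` is a left eigenvector of `A`, with the $j$-th conjugate of the generic element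
  -- as eigenvalue. Cancelling $\det M$ writes $\det A$ as the product of the conjugates.
  have hA : M.map C * (MvPolynomial.map (algebraMap K Ω)).mapMatrix A =
      Matrix.diagonal (fun j ↦ ∑ i, C (M j i) * X i) * M.map C := by
    ext1 j k
    rw [Matrix.diagonal_mul, Matrix.mul_apply]
    simp only [A, Matrix.map_apply, RingHom.mapMatrix_apply, Matrix.of_apply, map_sum, map_mul,
      map_C, map_X, Finset.mul_sum, Finset.sum_mul]
    rw [Finset.sum_comm]
    refine Finset.sum_congr rfl fun i _ ↦ ?_
    simp only [← mul_assoc, ← C_mul, ← Finset.sum_mul, ← map_sum]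
    rw [hmul, C_mul]
    ring
  obtain ⟨x, hx⟩ := hK.exists_eval_eq A.det hM (by
    have h := congrArg Matrix.det hA
    rw [Matrix.det_mul, Matrix.det_mul, Matrix.det_diagonal, mul_comm] at h
    refine (RingHom.map_det _ _).trans (mul_right_cancel₀ ?_ h)
    have := (RingHom.map_det (C (σ := Fin (n + 1))) M)
    rw [RingHom.mapMatrix_apply] at this
    rw [← this]
    exact C_ne_zero.2 hM) hc
  refine ⟨∑ i, x i • b i, ?_⟩
  rw [← hx, Algebra.norm_eq_matrix_det b, RingHom.map_det]
  congr 1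
  ext1 k l
  simp [A, Matrix.sum_apply, mul_comm]

/-! ### Diagonal forms and discriminants -/

section

open QuadraticMap Module

theorem QuadraticMap.equivalent_weightedSumSquares_cons {K : Type u} [Field K] {n : ℕ} (a : K)
    (w : Fin n → K) :
    Equivalent (weightedSumSquares K (Fin.cons a w : Fin (n + 1) → K))
      ((a • QuadraticMap.sq : QuadraticForm K K).prod (weightedSumSquares K w)) :=
  .symm ⟨{ Fin.consLinearEquiv K fun _ : Fin (n + 1) ↦ K with
    map_app' := fun x ↦ by
      simp [weightedSumSquares_apply, Fin.sum_univ_succ, Fin.consEquiv] }⟩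

theorem QuadraticMap.Equivalent.weightedSumSquares_cons {K : Type u} [Field K] {n : ℕ} (a : K)
    {w w' : Fin n → K} (h : Equivalent (weightedSumSquares K w) (weightedSumSquares K w')) :
    Equivalent (weightedSumSquares K (Fin.cons a w : Fin (n + 1) → K))
      (weightedSumSquares K (Fin.cons a w' : Fin (n + 1) → K)) :=
  (equivalent_weightedSumSquares_cons a w).trans <|
    ((Equivalent.refl _).prod h).trans (equivalent_weightedSumSquares_cons a w').symm

/-- If `a x² + b y²` represents `1`, then `⟨a, b⟩ ≅ ⟨ab, 1⟩`. -/
theorem QuadraticMap.equivalent_weightedSumSquares_cons_cons {K : Type u} [Field K] {n : ℕ}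
    {a b x y : K} (h : a * (x * x) + b * (y * y) = 1) (w : Fin n → K) :
    Equivalent
      (weightedSumSquares K (Fin.cons (a * b) (Fin.cons 1 w : Fin (n + 1) → K) : Fin (n + 2) → K))
      (weightedSumSquares K (Fin.cons a (Fin.cons b w : Fin (n + 1) → K) : Fin (n + 2) → K)) := by
  let f (p q r s : K) : (Fin (n + 2) → K) →ₗ[K] Fin (n + 2) → K :=
    { toFun := fun v ↦ Fin.cons (p * v 0 + q * v (Fin.succ 0))
        (Fin.cons (r * v 0 + s * v (Fin.succ 0)) fun i : Fin n ↦ v i.succ.succ : Fin (n + 1) → K)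
      map_add' := fun v v' ↦ by
        ext i; refine Fin.cases ?_ (Fin.cases ?_ fun i ↦ ?_) i <;> simp <;> ring
      map_smul' := fun c v ↦ by
        ext i; refine Fin.cases ?_ (Fin.cases ?_ fun i ↦ ?_) i <;> simp <;> ring }
  have hf (p q r s : K) (v) : f p q r s v = Fin.cons (p * v 0 + q * v (Fin.succ 0))
        (Fin.cons (r * v 0 + s * v (Fin.succ 0)) fun i : Fin n ↦ v i.succ.succ : Fin (n + 1) → K) := rfl
  -- The new basis of the plane is $(-by, ax), (x, y)$: orthogonal vectors with values $ab$ and $1$.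
  let e : (Fin (n + 2) → K) ≃ₗ[K] Fin (n + 2) → K :=
    LinearEquiv.ofLinearMap (f (-b * y) x (a * x) y) (f (-y) x (a * x) (b * y))
      (by
        refine LinearMap.ext fun v ↦ funext fun j ↦ ?_
        refine Fin.cases ?_ (Fin.cases ?_ fun j ↦ ?_) j <;>
          simp only [hf, LinearMap.comp_apply, LinearMap.id_apply, Fin.cons_zero, Fin.cons_succ]
        · linear_combination v 0 * h
        · linear_combination v (Fin.succ 0) * h)
      (by
        refine LinearMap.ext fun v ↦ funext fun j ↦ ?_
        refine Fin.cases ?_ (Fin.cases ?_ fun j ↦ ?_) j <;>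
          simp only [hf, LinearMap.comp_apply, LinearMap.id_apply, Fin.cons_zero, Fin.cons_succ]
        · linear_combination v 0 * h
        · linear_combination v (Fin.succ 0) * h)
  refine ⟨{ e with map_app' := fun v ↦ ?_ }⟩
  change weightedSumSquares K _ (f (-b * y) x (a * x) y v) = _
  simp only [weightedSumSquares_apply, Fin.sum_univ_succ, hf, Fin.cons_zero, Fin.cons_succ,
    smul_eq_mul]
  linear_combination (a * b * v 0 ^ 2 + v (Fin.succ 0) ^ 2) * h

/-- Over a field where nondegenerate binary forms represent `1`, a nondegenerate diagonal form
`⟨w₀, …, wₙ⟩` is equivalent to `⟨w₀ ⋯ wₙ, 1, …, 1⟩`. -/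
theorem QuadraticMap.equivalent_weightedSumSquares_prod {K : Type u} [Field K]
    (hK : ∀ a b : K, a ≠ 0 → b ≠ 0 → ∃ x y : K, a * (x * x) + b * (y * y) = 1) {n : ℕ}
    (w : Fin (n + 1) → K) (hw : ∀ i, w i ≠ 0) :
    Equivalent (weightedSumSquares K w)
      (weightedSumSquares K (Fin.cons (∏ i, w i) fun _ ↦ 1 : Fin (n + 1) → K)) := by
  induction n with
  | zero =>
    have : w = Fin.cons (∏ i, w i) fun _ ↦ 1 := by
      ext i
      rw [Fin.fin_one_eq_zero i]
      simp
    rw [← this]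
  | succ n ih =>
    have hprod : ∏ i : Fin (n + 1), w i.succ ≠ 0 := Finset.prod_ne_zero_iff.2 fun i _ ↦ hw _
    -- By induction the tail becomes $\langle p, 1, \dots, 1\rangle$ with $p$ its product; then
    -- $\langle w_0, p\rangle \cong \langle w_0 p, 1\rangle$.
    obtain ⟨x, y, h⟩ := hK (w 0) _ (hw 0) hprod
    have h1 := (ih (fun i ↦ w i.succ) fun i ↦ hw _).weightedSumSquares_cons (w 0)
    have h2 : (fun _ ↦ 1 : Fin (n + 1) → K) = Fin.cons 1 fun _ ↦ 1 := by
      ext i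
      refine Fin.cases ?_ (fun i ↦ ?_) i <;> simp
    have h3 := (equivalent_weightedSumSquares_cons_cons h fun _ : Fin n ↦ (1 : K)).symm
    rw [← h2, ← Fin.prod_univ_succ] at h3
    have h4 : (Fin.cons (w 0) fun i ↦ w i.succ : Fin (n + 2) → K) = w := Fin.cons_self_tail w
    rw [h4] at h1
    exact h1.trans h3

theorem QuadraticForm.discr'_weightedSumSquares {K : Type u} [Field K] [Invertible (2 : K)] {n : ℕ}
    (w : Fin n → K) : QuadraticForm.discr' (weightedSumSquares K w) = ∏ i, w i := by
  have : QuadraticForm.toMatrix' (weightedSumSquares K w) = Matrix.diagonal w := by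
    ext i j
    refine mul_left_cancel₀ (Invertible.ne_zero (2 : K)) ?_
    have hk (k : Fin n) : w k • (((Pi.single i 1 : Fin n → K) k + (Pi.single j 1 : Fin n → K) k) *
        ((Pi.single i 1 : Fin n → K) k + (Pi.single j 1 : Fin n → K) k)) -
        w k • ((Pi.single i 1 : Fin n → K) k * (Pi.single i 1 : Fin n → K) k) -
        w k • ((Pi.single j 1 : Fin n → K) k * (Pi.single j 1 : Fin n → K) k) =
        2 * ((Pi.single i 1 : Fin n → K) k * (w k * (Pi.single j 1 : Fin n → K) k)) := by
      simp only [smul_eq_mul]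
      ring
    have h := LinearMap.congr_fun₂ (two_nsmul_associated K (weightedSumSquares K w))
      (Pi.single i 1) (Pi.single j 1)
    simp only [LinearMap.smul_apply, nsmul_eq_mul, Nat.cast_ofNat, polarBilin_apply_apply, polar,
      weightedSumSquares_apply, Pi.add_apply, ← Finset.sum_sub_distrib, hk] at h
    rw [QuadraticForm.toMatrix', LinearMap.toMatrix₂'_apply, h, ← Finset.mul_sum]
    rcases eq_or_ne i j with rfl | hij
    · simp [Pi.single_apply]
    · simp [Pi.single_apply, hij, hij.symm]
  rw [QuadraticForm.discr', this, Matrix.det_diagonal]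

/-- The Gram entries are $\mathrm{Tr}(b_i \cdot \alpha b_j)$; expanding $\alpha b_j$ in the basis
separates the two factors. -/
theorem QuadraticForm.toMatrix_scaledTraceForm {K : Type u} {F : Type v} [Field K] [Field F]
    [Algebra K F] [Invertible (2 : K)] {n : ℕ} (b : Basis (Fin n) K F) (α : F) :
    (scaledTraceForm K F α).toMatrix b =
      Algebra.traceMatrix K b * Algebra.leftMulMatrix b α := by
  ext i j
  have h : (scaledTraceForm K F α).toMatrix b i j = Algebra.trace K F (b i * (α * b j)) := by
    refine mul_left_cancel₀ (Invertible.ne_zero (2 : K)) ?_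
    have h := LinearMap.congr_fun₂ (two_nsmul_associated K (scaledTraceForm K F α)) (b i) (b j)
    simp only [LinearMap.smul_apply, nsmul_eq_mul, Nat.cast_ofNat, polarBilin_apply_apply, polar,
      scaledTraceForm_apply, ← map_sub] at h
    rw [QuadraticForm.toMatrix, LinearMap.toMatrix₂_apply, h, two_mul, ← (Algebra.trace K F).map_add]
    congr 1
    ring
  rw [h, Matrix.mul_apply, ← b.sum_repr (α * b j), Finset.mul_sum, map_sum]
  simp [Algebra.leftMulMatrix_eq_repr_mul, Algebra.traceForm_apply, mul_comm]

theorem QuadraticForm.discr_scaledTraceForm {K : Type u} {F : Type v} [Field K] [Field F]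
    [Algebra K F] [Invertible (2 : K)] {n : ℕ} (b : Basis (Fin n) K F) (α : F) :
    (scaledTraceForm K F α).discr b = Algebra.discr K b * Algebra.norm K α := by
  rw [QuadraticForm.discr, toMatrix_scaledTraceForm, Matrix.det_mul, Algebra.discr_def,
    Algebra.norm_eq_matrix_det b]

/-- Over a field where nondegenerate binary forms represent `1`, a form of nonzero discriminant `d`
is equivalent to `⟨d, 1, …, 1⟩`. -/
theorem QuadraticForm.equivalent_of_discr {K : Type u} [Field K] [Invertible (2 : K)]
    (hK : ∀ a b : K, a ≠ 0 → b ≠ 0 → ∃ x y : K, a * (x * x) + b * (y * y) = 1)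
    {n : ℕ} {V : Type v} [AddCommGroup V] [Module K V] (b : Basis (Fin (n + 1)) K V)
    (Q : QuadraticForm K V) (hQ : Q.discr b ≠ 0) :
    Equivalent Q (weightedSumSquares K (Fin.cons (Q.discr b) fun _ ↦ 1 : Fin (n + 1) → K)) := by
  have := Module.Finite.of_basis b
  obtain ⟨w, ⟨e⟩⟩ : ∃ w : Fin (n + 1) → K, Equivalent Q (weightedSumSquares K w) := by
    have key : ∀ m, finrank K V = m → ∃ w : Fin m → K, Equivalent Q (weightedSumSquares K w) := by
      rintro _ rfl
      exact Q.equivalent_weightedSumSquares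
    exact key _ (by simp [finrank_eq_card_basis b])
  set f : V →ₗ[K] Fin (n + 1) → K := e.toLinearEquiv.toLinearMap
  have hcomp : Q = (weightedSumSquares K w).comp f := by
    ext x
    exact (e.map_app x).symm
  have hd : Q.discr b = (f.toMatrix b (Pi.basisFun K _)).det *
      (f.toMatrix b (Pi.basisFun K _)).det * ∏ i, w i := by
    rw [← QuadraticForm.discr'_weightedSumSquares, ← QuadraticForm.discr_eq_discr',
      ← QuadraticForm.discr_comp, ← hcomp]
  set δ := (f.toMatrix b (Pi.basisFun K _)).det
  have hδ : δ ≠ 0 := by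
    rintro h
    simp [hd, h] at hQ
  have hw : ∏ i, w i ≠ 0 := by
    rintro h
    simp [hd, h] at hQ
  refine Equivalent.trans ⟨e⟩ ((equivalent_weightedSumSquares_prod hK w fun i ↦
    Finset.prod_ne_zero_iff.1 hw i (Finset.mem_univ i)).trans (Equivalent.symm ⟨?_⟩))
  -- The discriminant in `b` is $\delta^2 \prod w_i$; rescaling the first coordinate by $\delta$
  -- absorbs the square.
  refine isometryEquivWeightedSumSquaresWeightedSumSquares
    (Fin.cons (Units.mk0 δ hδ) fun _ ↦ 1) fun i ↦ ?_
  refine Fin.cases ?_ (fun i ↦ ?_) i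
  · simp only [Fin.cons_zero, Units.val_mk0, hd]
    ring
  · simp

theorem QuadraticForm.discr_ne_zero_of_nondegenerate {K : Type u} [Field K] [Invertible (2 : K)]
    {n : ℕ} {V : Type v} [AddCommGroup V] [Module K V] (b : Basis (Fin n) K V)
    (Q : QuadraticForm K V) (hQ : Q.Nondegenerate) : Q.discr b ≠ 0 :=
  (LinearMap.BilinForm.nondegenerate_iff_det_ne_zero b).1 (nondegenerate_associated_iff.2 hQ)

end

theorem mainTheorem4 (K : Type u) [Field K] (hPAC : IsPAC K) (hchar : ringChar K ≠ 2)
    (n : ℕ) (V : Type v) [AddCommGroup V] [Module K V] [FiniteDimensional K V]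
    (hV : Module.finrank K V = n) (Q : QuadraticForm K V)
    (hQ : Q.Nondegenerate) :
    IsIsomorphicToScaledTraceForm Q ↔ HasSeparableExtensionOfDegree K n := by
  constructor
  · rintro ⟨F, _, _, hfin, hsep, α, -, ⟨e⟩⟩
    exact ⟨F, _, _, hfin, hsep, e.toLinearEquiv.finrank_eq.symm.trans hV⟩
  · rintro ⟨F, _, _, hfin, hsep, hF⟩
    have h2 : (2 : K) ≠ 0 := Ring.two_ne_zero hchar
    let := invertibleOfNonzero h2
    obtain ⟨n, rfl⟩ := Nat.exists_eq_succ_of_ne_zero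
      (hF ▸ (Module.finrank_pos (R := K) (M := F)).ne' : n ≠ 0)
    let b : Module.Basis (Fin (n + 1)) K V := Module.finBasisOfFinrankEq K V hV
    let b' : Module.Basis (Fin (n + 1)) K F := Module.finBasisOfFinrankEq K F hF
    have hd := QuadraticForm.discr_ne_zero_of_nondegenerate b Q hQ
    have hd' := Algebra.discr_not_zero_of_basis K b'
    -- This norm makes the two discriminants equal exactly, not merely up to squares.
    obtain ⟨α, hα⟩ := hPAC.exists_norm_eq (F := F) (div_ne_zero hd hd')
    have hdiscr : (scaledTraceForm K F α).discr b' = Q.discr b := by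
      rw [QuadraticForm.discr_scaledTraceForm, hα, mul_div_cancel₀ _ hd']
    have huniv (x y : K) (hx : x ≠ 0) (hy : y ≠ 0) :=
      hPAC.exists_binary_eq h2 hx hy one_ne_zero
    refine ⟨F, _, _, hfin, hsep, α, ?_, ?_⟩
    · rintro rfl
      rw [Algebra.norm_zero, eq_comm] at hα
      exact div_ne_zero hd hd' hα
    · have h := QuadraticForm.equivalent_of_discr huniv b' (scaledTraceForm K F α) (hdiscr ▸ hd)
      rw [hdiscr] at h
      exact (QuadraticForm.equivalent_of_discr huniv b Q hd).trans h.symm
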